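/- Let $d\ge 1$, let $U\subset\mathbf R^d$ be a bounded open set, and let $\rho\in\mathcal C(\overline U)$ be bounded away from zero, that is, $\rho\ge m$ on $\overline U$ for some constant $m>0$. Let $\mu$ be the measure on $\mathbf R^d$ given by $\mathrm d\mu(x)=\rho(x)\mathbf 1_{\overline U}(x)\,\mathrm dx$ (so that $\operatorname{supp}\mu=\overline U$). A function $u\in L^1(U)^d$ belongs to $\operatorname{BV}(U)^d$ if there is a finite $\mathbf R^{d\times d}$-valued Radon measure $Du$ on $U$ such that $$\int_U u_j\,\partial_i\varphi\,\mathrm dx=-\int_U\varphi\,\mathrm d(Du)_{ji}\qquad\text{for all }\varphi\in\mathcal C_{\mathrm c}^\infty(U),\ 1\le i,j\le d,$$ and $|Du|$ denotes the total variation measure of $Du$ with respect to the Frobenius norm. For $\lambda>0$ and $u\in (L^2(U)\cap\operatorname{BV}(U))^d$ define $$J_{\mu,\lambda,\infty}(u)=\int_U|u(x)-x|^2\,\mathrm d\mu(x)+c\lambda\int_U\rho(x)^2\,\mathrm d|Du|(x),\qquad c=\int_{\mathbf R^d}e^{-|y|}\,|y\cdot \mathrm e_1|\,\mathrm dy,$$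 where $\mathrm e_1$ is the first standard basis vector. Then for every $\lambda>0$ the functional $J_{\mu,\lambda,\infty}$ has a unique minimizer in $(L^2(U)\cap\operatorname{BV}(U))^d$, where functions that agree almost everywhere on $U$ are identified. -/

import Mathlib

open MeasureTheory Set
open scoped ContDiff ENNReal

/-- The Euclidean space `ℝ^d`. -/
abbrev Rd (d : ℕ) : Type := EuclideanSpace ℝ (Fin d)

/-- The `d × d` real matrices, identified with vectors of length `d²`, so that the norm is the
Frobenius norm. The entry `(j, i)` of a gradient is the `i`-th partial derivative of the `j`-th
component. -/
abbrev RdMat (d : ℕ) : Type := EuclideanSpace ℝ (Fin d × Fin d)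

/-- The matrix-valued measure `T` on `U` (that is, a vector measure on `ℝ^d` with
`|T|(ℝ^d ∖ U) = 0`) is the distributional gradient of `u : U → ℝ^d`:
`∫_U u_j ∂_i φ dx = - ∫_U φ dT_{j i}` for all `φ ∈ C_c^∞(U)` and all `i, j`.
A vector measure has values in the finite-dimensional space of matrices, so it is a
matrix-valued finite Radon measure. -/
def IsGradientMeasure {d : ℕ} (U : Set (Rd d)) (u : Rd d → Rd d)
    (T : VectorMeasure (Rd d) (RdMat d)) : Prop :=
  T.variation Uᶜ = 0 ∧
    ∀ φ : Rd d → ℝ, ContDiff ℝ ∞ φ → HasCompactSupport φ → tsupport φ ⊆ U →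
      ∀ i j : Fin d,
        ∫ x in U, u x j * fderiv ℝ φ x (EuclideanSpace.single i 1) =
          -((∫ᵛ x, φ x ∂•T) (j, i))

/-- `u ∈ (BV(U))^d`: `u` is integrable on `U` and its distributional gradient is a
finite matrix-valued Radon measure on `U`. -/
def MemBV {d : ℕ} (U : Set (Rd d)) (u : Rd d → Rd d) : Prop :=
  IntegrableOn u U volume ∧ ∃ T : VectorMeasure (Rd d) (RdMat d), IsGradientMeasure U u T

open Classical in
/-- The gradient measure `Du` of `u ∈ (BV(U))^d` (and `0` for other functions). For open `U` the
gradient measure is determined by `u`, as `C_c^∞` test functions separate finite Radon measures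
on `U`. -/
noncomputable def gradientMeasure {d : ℕ} (U : Set (Rd d)) (u : Rd d → Rd d) :
    VectorMeasure (Rd d) (RdMat d) :=
  if h : MemBV U u then h.2.choose else 0

/-- The constant `c = ∫_{ℝ^d} e^{-|y|} |y · e₁| dy`. -/
noncomputable def fusionConst (d : ℕ) [NeZero d] : ℝ :=
  ∫ y : Rd d, Real.exp (-‖y‖) * |inner ℝ y (EuclideanSpace.single (0 : Fin d) (1 : ℝ))|

/-- The gradient functional
`J(u) = ∫_U |u(x) - x|² dμ(x) + c λ ∫_U ρ(x)² d|Du|(x)`. -/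
noncomputable def gradientFunctional {d : ℕ} [NeZero d] (U : Set (Rd d)) (μ : Measure (Rd d))
    (ρ : Rd d → ℝ) (lam : ℝ) (u : Rd d → Rd d) : ℝ :=
  (∫ x in U, ‖u x - x‖ ^ 2 ∂μ) +
    fusionConst d * lam * (∫ x in U, ρ x ^ 2 ∂(gradientMeasure U u).variation)

/-- The space `(L²(U) ∩ BV(U))^d`, as a subset of `L²(U; ℝ^d)`, whose elements are classes of
functions up to equality almost everywhere on `U`. -/
def L2BV {d : ℕ} (U : Set (Rd d)) : Set (Lp (Rd d) 2 (volume.restrict U)) :=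
  {u | MemBV U u}

/-! The functional is `J u = ‖u - id‖² + R u`, with the norm of `L²(μ)` on `U` and the convex
penalty `R u = cλ ∫ ρ² d|Du|`. Let `I` be its infimum. Comparing `I` with the value at a midpoint,
the parallelogram identity gives `‖u - v‖² ≤ 2 (J u - I) + 2 (J v - I)`. Hence minimizers are unique
and minimizing sequences are Cauchy. Since `m ≤ ρ ≤ M` on the closure of `U`, this norm is
equivalent to that of `L²(U)`, so a minimizing sequence converges strongly; no compactness theorem
in BV and no regularity of the boundary is involved. This is `existsUnique_isMinOn_norm_sq_add`.

It remains to see that the limit `v` lies in BV and that `R` is lower semicontinuous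
(`IsGradientMeasure.exists_of_tendsto`). The measures `ρ²|Du_n|` have bounded mass on a compact set,
so they have a narrow limit `ν₀`, of mass `L = lim ∫ ρ² d|Du_n|`. With `σ = ρ⁻² ν₀` on `U`, the
bounds `|⟨Du_n, Φ⟩| ≤ ∫ |Φ| d|Du_n|` pass to `|⟨Dv, Φ⟩| ≤ ∫ |Φ| dσ`. A Riesz argument in `L²(σ)`
(`testFunctions.exists_density`) yields `Dv = g σ` with `|g| ≤ 1`, hence `∫ ρ² d|Dv| ≤ ν₀(U) ≤ L`.
-/

/-! ### Vector measures with values in a Euclidean space -/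

namespace MeasureTheory.VectorMeasure

variable {X ι : Type*} {mX : MeasurableSpace X} [Fintype ι]

/-- The signed measure given by a coordinate of a vector measure. -/
noncomputable def coord (T : VectorMeasure X (EuclideanSpace ℝ ι)) (i : ι) : SignedMeasure X :=
  T.mapRange (EuclideanSpace.proj (𝕜 := ℝ) i : EuclideanSpace ℝ ι →L[ℝ] ℝ).toLinearMap.toAddMonoidHom
    (EuclideanSpace.proj (𝕜 := ℝ) i).continuous

omit [Fintype ι] in
lemma coord_apply (T : VectorMeasure X (EuclideanSpace ℝ ι)) (i : ι) (s : Set X) :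
    T.coord i s = T s i := rfl

/-- A vector measure with values in a Euclidean space has an integrable density with respect to
some finite measure. -/
lemma exists_eq_withDensityᵥ (T : VectorMeasure X (EuclideanSpace ℝ ι)) :
    ∃ (σ : Measure X) (g : X → EuclideanSpace ℝ ι), IsFiniteMeasure σ ∧ Integrable g σ ∧
      T = σ.withDensityᵥ g := by
  classical
  -- This finite measure dominates every coordinate of `T`, so Radon–Nikodym applies to each
  -- coordinate separately.
  let σ : Measure X := ∑ i, (T.coord i).totalVariation
  have hσ : IsFiniteMeasure σ := by
    refine ⟨?_⟩
    simp only [σ, Measure.coe_finsetSum, Finset.sum_apply]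
    exact ENNReal.sum_lt_top.2 fun i _ => measure_lt_top _ _
  have hac : ∀ i, T.coord i ≪ᵥ σ.toENNRealVectorMeasure := by
    intro i
    refine VectorMeasure.AbsolutelyContinuous.mk fun A hA h0 => ?_
    rw [Measure.toENNRealVectorMeasure_apply_measurable hA] at h0
    have h1 : (T.coord i).totalVariation A = 0 := by
      refine le_antisymm ?_ bot_le
      rw [← h0]
      simp only [σ, Measure.coe_finsetSum, Finset.sum_apply]
      exact Finset.single_le_sum (f := fun j => (T.coord j).totalVariation A)
        (fun _ _ => bot_le) (Finset.mem_univ i)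
    have h2 := (T.coord i).enorm_le_totalVariation A
    rw [h1] at h2
    simpa using h2
  have hden := fun i => (SignedMeasure.absolutelyContinuous_iff_withDensityᵥ_rnDeriv_eq _ _).1 (hac i)
  have hint : ∀ i, Integrable ((T.coord i).rnDeriv σ) σ := fun i =>
    SignedMeasure.integrable_rnDeriv _ _
  let g : X → EuclideanSpace ℝ ι := fun x =>
    ∑ i, (T.coord i).rnDeriv σ x • EuclideanSpace.single i (1 : ℝ)
  have hg : Integrable g σ := integrable_finsetSum _ fun i _ => (hint i).smul_const _
  refine ⟨σ, g, hσ, hg, ?_⟩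
  ext A hA j
  rw [withDensityᵥ_apply hg hA]
  have h1 : T A j = ∫ x in A, (T.coord j).rnDeriv σ x ∂σ := by
    rw [← coord_apply, ← withDensityᵥ_apply (hint j) hA, hden j]
  rw [h1]
  have := (EuclideanSpace.proj (𝕜 := ℝ) j : EuclideanSpace ℝ ι →L[ℝ] ℝ).integral_comp_comm
    (hg.restrict (s := A))
  simp only [PiLp.proj_apply] at this
  rw [← this]
  congr 1
  ext x
  simp [g, Pi.single_apply]

/-- For `T = g σ` the variation is `|g| σ`, and `g` is integrable. -/
instance isFiniteMeasure_variation (T : VectorMeasure X (EuclideanSpace ℝ ι)) :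
    IsFiniteMeasure T.variation := by
  obtain ⟨σ, g, hσ, hg, rfl⟩ := T.exists_eq_withDensityᵥ
  rw [Measure.variation_withDensityᵥ hg]
  exact isFiniteMeasure_withDensity hg.2.ne

/-- The integral of a bounded function against a vector measure with density. -/
lemma integral_smul_withDensityᵥ {σ : Measure X} {g : X → EuclideanSpace ℝ ι}
    (hg : Integrable g σ) {f : X → ℝ} (hf : StronglyMeasurable f) {C : ℝ} (hC : ∀ x, ‖f x‖ ≤ C) :
    ∫ᵛ x, f x ∂•(σ.withDensityᵥ g) = ∫ x, f x • g x ∂σ := by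
  have hsimple : ∀ s : SimpleFunc X ℝ,
      ∫ᵛ x, s x ∂•(σ.withDensityᵥ g) = ∫ x, s x • g x ∂σ := by
    intro s
    induction s using SimpleFunc.induction with
    | const c hs =>
      rename_i s
      have h1 : ⇑(SimpleFunc.piecewise s hs (SimpleFunc.const X c) (SimpleFunc.const X 0)) =
          s.indicator (fun _ => c) := by
        ext x; simp [Set.indicator, Set.piecewise]
      rw [h1, integral_indicator_const _ hs, withDensityᵥ_apply hg hs]
      have h2 : (fun x => s.indicator (fun _ => c) x • g x) = s.indicator (fun x => c • g x) := by
        ext1 x; by_cases hx : x ∈ s <;> simp [hx]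
      rw [h2, MeasureTheory.integral_indicator hs, MeasureTheory.integral_smul]
      rfl
    | add hd hf hg' =>
      rename_i f₁ f₂
      have hb : ∀ k : SimpleFunc X ℝ, Integrable k (σ.withDensityᵥ g).variation := fun k =>
        SimpleFunc.integrable_of_isFiniteMeasure k
      have hb' : ∀ k : SimpleFunc X ℝ, Integrable (fun x => k x • g x) σ := fun k => by
        obtain ⟨C, hC⟩ := k.exists_forall_norm_le
        exact hg.bdd_smul C k.aestronglyMeasurable (Filter.Eventually.of_forall hC)
      simp only [SimpleFunc.coe_add, Pi.add_apply, add_smul]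
      rw [integral_fun_add (hb _) (hb _), hf, hg', MeasureTheory.integral_add (hb' _) (hb' _)]
  rcases isEmpty_or_nonempty X with hX | ⟨⟨x₀⟩⟩
  · rw [integral_of_isEmpty]
    simp [Measure.eq_zero_of_isEmpty σ]
  have hC0 : 0 ≤ C := (norm_nonneg _).trans (hC x₀)
  have h1 : Filter.Tendsto (fun n => ∫ᵛ x, hf.approxBounded C n x ∂•(σ.withDensityᵥ g))
      Filter.atTop (nhds (∫ᵛ x, f x ∂•(σ.withDensityᵥ g))) := by
    refine tendsto_integral_of_dominated_convergence (fun _ => C) (fun n => ?_)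
      (integrable_const _) (fun n => ?_) ?_
    · exact (SimpleFunc.aestronglyMeasurable _)
    · exact Filter.Eventually.of_forall fun x => hf.norm_approxBounded_le hC0 n x
    · exact Filter.Eventually.of_forall fun x => hf.tendsto_approxBounded_of_norm_le (hC x)
  have h2 : Filter.Tendsto (fun n => ∫ x, hf.approxBounded C n x • g x ∂σ)
      Filter.atTop (nhds (∫ x, f x • g x ∂σ)) := by
    refine MeasureTheory.tendsto_integral_of_dominated_convergence (fun x => C * ‖g x‖)
      (fun n => ?_) (hg.norm.const_mul C) (fun n => ?_) ?_
    · exact (hf.approxBounded C n).aestronglyMeasurable.smul hg.1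
    · refine Filter.Eventually.of_forall fun x => ?_
      rw [norm_smul]
      gcongr
      exact hf.norm_approxBounded_le hC0 n x
    · exact Filter.Eventually.of_forall fun x =>
        (hf.tendsto_approxBounded_of_norm_le (hC x)).smul_const _
  simp_rw [hsimple] at h1
  exact tendsto_nhds_unique h1 h2

/-- The sum of the coordinatewise integrals of a vector-valued function is controlled by the
integral of its norm against the variation. -/
lemma abs_sum_integral_coord_le (T : VectorMeasure X (EuclideanSpace ℝ ι))
    {f : X → EuclideanSpace ℝ ι} (hf : Integrable f T.variation) :
    |∑ i, (∫ᵛ x, f x i ∂•T) i| ≤ ∫ x, ‖f x‖ ∂T.variation := by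
  have h1 : ∀ i, (∫ᵛ x, f x i ∂•T) i = ∫ᵛ x, f x
      ∂[((ContinuousLinearMap.compL ℝ _ _ _ (EuclideanSpace.proj (𝕜 := ℝ) i)) ∘L
        (ContinuousLinearMap.lsmul ℝ ℝ)) ∘L (EuclideanSpace.proj (𝕜 := ℝ) i); T] := by
    intro i
    have hfi : Integrable (fun x => f x i) T.variation :=
      (EuclideanSpace.proj (𝕜 := ℝ) i : EuclideanSpace ℝ ι →L[ℝ] ℝ).integrable_comp hf
    have := continuousLinearMap_apply_integral (B := ContinuousLinearMap.lsmul ℝ ℝ)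
      (C := (EuclideanSpace.proj (𝕜 := ℝ) i : EuclideanSpace ℝ ι →L[ℝ] ℝ)) (μ := T) hfi
    simp only [PiLp.proj_apply] at this
    rw [this, ← integral_continuousLinearMap_comp hf]
    rfl
  simp_rw [h1]
  rw [← integral_finsetSum_cbm hf, ← Real.norm_eq_abs]
  -- The coordinatewise pairings add up to the inner product, a bilinear form of norm at most one;
  -- this gives the Frobenius norm with constant one.
  have h2 : (∑ i, ((ContinuousLinearMap.compL ℝ _ _ _ (EuclideanSpace.proj (𝕜 := ℝ) i)) ∘L
        (ContinuousLinearMap.lsmul ℝ ℝ (E := EuclideanSpace ℝ ι))) ∘L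
          (EuclideanSpace.proj (𝕜 := ℝ) i : EuclideanSpace ℝ ι →L[ℝ] ℝ)) =
      (innerSL ℝ : EuclideanSpace ℝ ι →L[ℝ] EuclideanSpace ℝ ι →L[ℝ] ℝ) := by
    ext x y
    change _ = inner ℝ x y
    simp [PiLp.inner_apply, mul_comm]
  rw [h2]
  refine norm_integral_le_integral_norm.trans ?_
  refine mul_le_of_le_one_left (integral_nonneg fun _ => norm_nonneg _) ?_
  exact norm_innerSL_le ℝ

end MeasureTheory.VectorMeasure

/-! ### Test functions and a Riesz representation for functionals on them -/

/-- The space of smooth functions with compact support in `U`. -/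
def testFunctions {E : Type*} [NormedAddCommGroup E] [NormedSpace ℝ E] (U : Set E)
    (F : Type*) [NormedAddCommGroup F] [NormedSpace ℝ F] : Submodule ℝ (E → F) where
  carrier := {Φ | ContDiff ℝ ∞ Φ ∧ HasCompactSupport Φ ∧ tsupport Φ ⊆ U}
  zero_mem' := ⟨contDiff_const, HasCompactSupport.zero, by simp⟩
  add_mem' := fun {f g} hf hg => ⟨hf.1.add hg.1, hf.2.1.add hg.2.1,
    (tsupport_add f g).trans (union_subset hf.2.2 hg.2.2)⟩
  smul_mem' := fun c f hf => ⟨hf.1.const_smul c, hf.2.1.smul_left (f := fun _ => c),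
    (tsupport_smul_subset_right (fun _ => c) f).trans hf.2.2⟩

lemma integral_norm_le_mul_norm_L2 {X F : Type*} [MeasurableSpace X] [NormedAddCommGroup F]
    (σ : Measure X) [IsFiniteMeasure σ] (f : Lp F 2 σ) :
    ∫ x, ‖f x‖ ∂σ ≤ (σ univ ^ (1 / 2 : ℝ)).toReal * ‖f‖ := by
  have h := eLpNorm_le_eLpNorm_mul_rpow_measure_univ (μ := σ) (p := 1) (q := 2) one_le_two
    (Lp.aestronglyMeasurable f)
  have h2 : (1 / (1 : ℝ≥0∞).toReal - 1 / (2 : ℝ≥0∞).toReal) = (1 / 2 : ℝ) := by norm_num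
  rw [h2] at h
  rw [integral_norm_eq_lintegral_enorm (Lp.aestronglyMeasurable f), ← eLpNorm_one_eq_lintegral_enorm,
    Lp.norm_def, ← ENNReal.toReal_mul, mul_comm]
  exact ENNReal.toReal_mono (ENNReal.mul_ne_top (Lp.eLpNorm_ne_top f)
    (ENNReal.rpow_ne_top_of_nonneg (by norm_num) (measure_ne_top _ _))) h

lemma continuous_integral_norm_L2 {X F : Type*} [MeasurableSpace X] [NormedAddCommGroup F]
    (σ : Measure X) [IsFiniteMeasure σ] :
    Continuous fun f : Lp F 2 σ => ∫ x, ‖f x‖ ∂σ := by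
  have hint : ∀ f : Lp F 2 σ, Integrable f σ := fun f => (Lp.memLp f).integrable one_le_two
  have key : ∀ f g : Lp F 2 σ, ∫ x, ‖f x‖ ∂σ ≤
      ∫ x, ‖g x‖ ∂σ + (σ univ ^ (1 / 2 : ℝ)).toReal * dist f g := by
    intro f g
    rw [dist_eq_norm]
    refine le_trans ?_ (add_le_add_right (integral_norm_le_mul_norm_L2 σ (f - g)) _)
    rw [← integral_add (hint g).norm (hint _).norm]
    refine integral_mono_ae (hint f).norm ((hint g).norm.add (hint _).norm) ?_
    filter_upwards [Lp.coeFn_sub f g] with x hx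
    rw [hx]
    simpa using norm_add_le (g x) (f x - g x)
  exact (LipschitzWith.of_le_add_mul (σ univ ^ (1 / 2 : ℝ)).toNNReal key).continuous

section Representation

variable {E : Type*} [NormedAddCommGroup E] [NormedSpace ℝ E] [FiniteDimensional ℝ E]
  [MeasurableSpace E] [BorelSpace E] {ι : Type*} [Fintype ι]

omit [FiniteDimensional ℝ E] in
lemma testFunctions.memLp {U : Set E} {F : Type*} [NormedAddCommGroup F] [NormedSpace ℝ F]
    (Φ : testFunctions U F) (p : ℝ≥0∞) (σ : Measure E) [IsFiniteMeasureOnCompacts σ] :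
    MemLp (Φ : E → F) p σ :=
  Φ.2.1.continuous.memLp_of_hasCompactSupport Φ.2.2.1

/-- The embedding of the test functions into `L²(σ)`. -/
noncomputable def testFunctions.toL2 (U : Set E) (F : Type*) [NormedAddCommGroup F]
    [NormedSpace ℝ F] (σ : Measure E) [IsFiniteMeasureOnCompacts σ] :
    testFunctions U F →ₗ[ℝ] Lp F 2 σ where
  toFun Φ := (testFunctions.memLp Φ 2 σ).toLp _
  map_add' _ _ := rfl
  map_smul' _ _ := rfl

omit [FiniteDimensional ℝ E] in
lemma testFunctions.coeFn_toL2 (U : Set E) (F : Type*) [NormedAddCommGroup F]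
    [NormedSpace ℝ F] (σ : Measure E) [IsFiniteMeasureOnCompacts σ] (Φ : testFunctions U F) :
    toL2 U F σ Φ =ᵐ[σ] Φ :=
  (testFunctions.memLp Φ 2 σ).coeFn_toLp

omit [FiniteDimensional ℝ E] [MeasurableSpace E] [BorelSpace E] in
lemma testFunctions.smul_single_mem [DecidableEq ι] {U : Set E} {φ : E → ℝ}
    (hφ : φ ∈ testFunctions U ℝ) (i : ι) :
    (fun x => φ x • EuclideanSpace.single i (1 : ℝ)) ∈ testFunctions U (EuclideanSpace ℝ ι) :=
  ⟨hφ.1.smul contDiff_const, hφ.2.1.smul_right,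
    (tsupport_smul_subset_left φ (fun _ => EuclideanSpace.single i (1 : ℝ))).trans hφ.2.2⟩

/-- If `h` is orthogonal to all `φ eᵢ`, each coordinate of `h` vanishes almost everywhere on `U`,
and `σ` does not charge the complement. -/
lemma testFunctions.denseRange_toL2 {U : Set E} (hU : IsOpen U) (σ : Measure E)
    [IsFiniteMeasure σ] (hσ : σ Uᶜ = 0) :
    DenseRange (toL2 U (EuclideanSpace ℝ ι) σ) := by
  classical
  rw [DenseRange, ← LinearMap.coe_range, Submodule.dense_iff_topologicalClosure_eq_top,
    Submodule.topologicalClosure_eq_top_iff, Submodule.eq_bot_iff]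
  intro h hh
  rw [Submodule.mem_orthogonal] at hh
  have hint : Integrable h σ := (Lp.memLp h).integrable one_le_two
  have hinti : ∀ i, Integrable (fun x => h x i) σ := fun i =>
    (EuclideanSpace.proj (𝕜 := ℝ) i : EuclideanSpace ℝ ι →L[ℝ] ℝ).integrable_comp hint
  have hz : ∀ i, ∀ᵐ x ∂σ, x ∈ U → h x i = 0 := by
    intro i
    refine hU.ae_eq_zero_of_integral_contDiff_smul_eq_zero
      ((hinti i).locallyIntegrable.locallyIntegrableOn U) fun φ h1 h2 h3 => ?_
    let Φ : testFunctions U (EuclideanSpace ℝ ι) :=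
      ⟨_, testFunctions.smul_single_mem (φ := φ) ⟨h1, h2, h3⟩ i⟩
    have := hh _ ⟨Φ, rfl⟩
    rw [L2.inner_def] at this
    rw [← this]
    refine integral_congr_ae ?_
    filter_upwards [testFunctions.coeFn_toL2 U _ σ Φ] with x hx
    rw [hx]
    simp [Φ, inner_smul_left, EuclideanSpace.inner_single_left]
  have hU' : ∀ᵐ x ∂σ, x ∈ U := mem_ae_iff.2 hσ
  rw [Lp.eq_zero_iff_ae_eq_zero]
  filter_upwards [ae_all_iff.2 hz, hU'] with x hx hxU
  ext i
  exact hx i hxU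

/-- A linear functional on the test functions bounded by the `L¹(σ)` norm is given by a density
which is bounded by one. -/
lemma testFunctions.exists_density {U : Set E} (hU : IsOpen U) (σ : Measure E)
    [IsFiniteMeasure σ] (hσ : σ Uᶜ = 0) (ℓ : testFunctions U (EuclideanSpace ℝ ι) →ₗ[ℝ] ℝ)
    (hℓ : ∀ Φ, |ℓ Φ| ≤ ∫ x, ‖(Φ : E → EuclideanSpace ℝ ι) x‖ ∂σ) :
    ∃ g : E → EuclideanSpace ℝ ι, Integrable g σ ∧ (∀ᵐ x ∂σ, ‖g x‖ ≤ 1) ∧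
      ∀ Φ : testFunctions U (EuclideanSpace ℝ ι), ℓ Φ = ∫ x, inner ℝ (g x) (Φ.1 x) ∂σ := by
  have hdense := testFunctions.denseRange_toL2 (ι := ι) hU σ hσ
  have hnorm : ∀ Φ, ∫ x, ‖toL2 U (EuclideanSpace ℝ ι) σ Φ x‖ ∂σ =
      ∫ x, ‖(Φ : E → EuclideanSpace ℝ ι) x‖ ∂σ := fun Φ =>
    integral_congr_ae ((testFunctions.coeFn_toL2 U _ σ Φ).fun_comp norm)
  have hℓC : ∃ C : ℝ, ∀ Φ, ‖ℓ Φ‖ ≤ C * ‖toL2 U (EuclideanSpace ℝ ι) σ Φ‖ :=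
    ⟨_, fun Φ => (hℓ Φ).trans ((hnorm Φ).symm.le.trans (integral_norm_le_mul_norm_L2 σ _))⟩
  -- On a finite measure the `L¹` norm is controlled by the `L²` norm, so the functional extends to
  -- `L²(σ)`, where the Hilbert space Riesz theorem supplies `g`. The sharper `L¹` bound survives by
  -- density.
  let L : Lp (EuclideanSpace ℝ ι) 2 σ →L[ℝ] ℝ :=
    ℓ.extendOfNorm (toL2 U (EuclideanSpace ℝ ι) σ)
  have hLe : ∀ Φ, L (toL2 U _ σ Φ) = ℓ Φ := ℓ.extendOfNorm_eq hdense hℓC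
  have hLb : ∀ f, |L f| ≤ ∫ x, ‖f x‖ ∂σ := by
    intro f
    refine hdense.induction_on f (isClosed_le (by fun_prop) (continuous_integral_norm_L2 σ)) fun Φ => ?_
    rw [hLe, hnorm]
    exact hℓ Φ
  let g := (InnerProductSpace.toDual ℝ (Lp (EuclideanSpace ℝ ι) 2 σ)).symm L
  have hg : ∀ f, L f = ∫ x, inner ℝ (g x) (f x) ∂σ := fun f => by
    rw [← L2.inner_def, InnerProductSpace.toDual_symm_apply]
  have hgi : Integrable g σ := (Lp.memLp g).integrable one_le_two
  refine ⟨g, hgi, ?_, fun Φ => ?_⟩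
  -- Testing the `L¹` bound with `g` cut off to `{|g| > 1}` gives `∫_A (|g|² - |g|) ≤ 0` with a
  -- positive integrand on `A`, so `A` is null.
  · let A : Set E := {x | 1 < ‖g x‖}
    have hA : MeasurableSet A :=
      measurableSet_lt measurable_const (Lp.stronglyMeasurable g).measurable.norm
    have hfm : MemLp (A.indicator g) 2 σ := (Lp.memLp g).indicator hA
    have h1 := hLb (hfm.toLp _)
    rw [hg] at h1
    have h2 : ∫ x, inner ℝ (g x) (hfm.toLp _ x) ∂σ = ∫ x in A, ‖g x‖ ^ 2 ∂σ := by
      rw [← integral_indicator hA]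
      refine integral_congr_ae ?_
      filter_upwards [hfm.coeFn_toLp] with x hx
      rw [hx]
      by_cases hxA : x ∈ A <;> simp [hxA]
    have h3 : ∫ x, ‖hfm.toLp _ x‖ ∂σ = ∫ x in A, ‖g x‖ ∂σ := by
      rw [← integral_indicator hA]
      refine integral_congr_ae ?_
      filter_upwards [hfm.coeFn_toLp] with x hx
      rw [hx]
      by_cases hxA : x ∈ A <;> simp [hxA]
    rw [h2, h3] at h1
    have h4 : IntegrableOn (fun x => ‖g x‖ ^ 2 - ‖g x‖) A σ :=
      ((Lp.memLp g).integrable_norm_pow two_ne_zero |>.sub hgi.norm).integrableOn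
    have h5 : ∫ x in A, (‖g x‖ ^ 2 - ‖g x‖) ∂σ ≤ 0 := by
      rw [integral_sub ((Lp.memLp g).integrable_norm_pow two_ne_zero).integrableOn
        hgi.norm.integrableOn]
      linarith [le_abs_self (∫ x in A, ‖g x‖ ^ 2 ∂σ)]
    have h6 : ∀ x ∈ A, 0 < ‖g x‖ ^ 2 - ‖g x‖ := fun x hx => by
      have : 1 < ‖g x‖ := hx
      nlinarith
    have h7 : σ A = 0 := by
      by_contra hne
      have := (setIntegral_pos_iff_support_of_nonneg_ae
        ((ae_restrict_iff' hA).2 (Filter.Eventually.of_forall fun x hx => (h6 x hx).le)) h4).2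
      refine absurd (this ?_) (not_lt.2 h5)
      have h8 : Function.support (fun x => ‖g x‖ ^ 2 - ‖g x‖) ∩ A = A :=
        inter_eq_right.2 fun x hx => (h6 x hx).ne'
      rw [h8]
      exact pos_iff_ne_zero.2 hne
    rw [ae_iff]
    simpa [A] using h7
  · rw [← hLe, hg]
    refine integral_congr_ae ?_
    filter_upwards [testFunctions.coeFn_toL2 U _ σ Φ] with x hx
    rw [hx]

end Representation

/-! ### Uniqueness and linearity of the gradient measure -/

lemma MeasureTheory.VectorMeasure.eq_zero_of_integral_testFunctions_eq_zero {E : Type*} [NormedAddCommGroup E]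
    [NormedSpace ℝ E] [FiniteDimensional ℝ E] [MeasurableSpace E] [BorelSpace E] {ι : Type*}
    [Fintype ι] {U : Set E} (hU : IsOpen U) (T : VectorMeasure E (EuclideanSpace ℝ ι))
    (hT : T.variation Uᶜ = 0) (h : ∀ φ ∈ testFunctions U ℝ, ∫ᵛ x, φ x ∂•T = 0) : T = 0 := by
  obtain ⟨σ, g, hσ, hg, rfl⟩ := T.exists_eq_withDensityᵥ
  have h1 : ∀ᵐ x ∂σ, x ∈ U → g x = 0 := by
    refine hU.ae_eq_zero_of_integral_contDiff_smul_eq_zero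
      (hg.locallyIntegrable.locallyIntegrableOn U) fun φ h1 h2 h3 => ?_
    obtain ⟨C, hC⟩ := h1.continuous.bounded_above_of_compact_support h2
    rw [← VectorMeasure.integral_smul_withDensityᵥ hg h1.continuous.stronglyMeasurable hC]
    exact h φ ⟨h1, h2, h3⟩
  rw [← VectorMeasure.variation_eq_zero]
  have h2 : (σ.withDensityᵥ g).variation U = 0 := by
    rw [Measure.variation_withDensityᵥ hg, MeasureTheory.withDensity_apply _ hU.measurableSet,
      lintegral_eq_zero_iff' hg.1.enorm.restrict]
    exact (ae_restrict_iff' hU.measurableSet).2 (h1.mono fun x hx hxU => by simp [hx hxU])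
  rw [← Measure.measure_univ_eq_zero, ← union_compl_self U]
  exact measure_union_null h2 hT

namespace IsGradientMeasure

variable {d : ℕ} {U : Set (Rd d)} {u v : Rd d → Rd d} {T S : VectorMeasure (Rd d) (RdMat d)}

lemma congr (h : IsGradientMeasure U u T) (huv : u =ᵐ[volume.restrict U] v) :
    IsGradientMeasure U v T := by
  refine ⟨h.1, fun φ h1 h2 h3 i j => ?_⟩
  rw [← h.2 φ h1 h2 h3 i j]
  refine integral_congr_ae ?_
  filter_upwards [huv] with x hx
  rw [hx]

lemma unique (hU : IsOpen U) (hT : IsGradientMeasure U u T) (hS : IsGradientMeasure U u S) :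
    T = S := by
  rw [← sub_eq_zero]
  refine VectorMeasure.eq_zero_of_integral_testFunctions_eq_zero hU _ ?_ fun φ hφ => ?_
  · have h1 : (T.variation + S.variation) Uᶜ = 0 := by simp [hT.1, hS.1]
    exact le_antisymm ((VectorMeasure.variation_sub_le (μ := T) (ν := S) Uᶜ).trans h1.le) bot_le
  · have hi : ∀ R : VectorMeasure (Rd d) (RdMat d), R.Integrable φ := fun R =>
      memLp_one_iff_integrable.1 (testFunctions.memLp ⟨φ, hφ⟩ 1 R.variation)
    rw [VectorMeasure.integral_sub_vectorMeasure (hi T) (hi S), sub_eq_zero]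
    ext ⟨j, i⟩
    have h1 := hT.2 φ hφ.1 hφ.2.1 hφ.2.2 i j
    have h2 := hS.2 φ hφ.1 hφ.2.1 hφ.2.2 i j
    linarith

lemma integrable_mul_fderiv (hu : IntegrableOn u U) {φ : Rd d → ℝ} (hφ : φ ∈ testFunctions U ℝ)
    (i j : Fin d) :
    IntegrableOn (fun x => u x j * fderiv ℝ φ x (EuclideanSpace.single i 1)) U := by
  have h1 : IntegrableOn (fun x => u x j) U :=
    (EuclideanSpace.proj (𝕜 := ℝ) j : Rd d →L[ℝ] ℝ).integrable_comp hu
  have hc : Continuous fun x => fderiv ℝ φ x (EuclideanSpace.single i 1) :=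
    (hφ.1.continuous_fderiv (by simp)).clm_apply continuous_const
  have hs : HasCompactSupport fun x => fderiv ℝ φ x (EuclideanSpace.single i 1) :=
    hφ.2.1.fderiv_apply ℝ (EuclideanSpace.single i 1)
  obtain ⟨C, hC⟩ := hc.bounded_above_of_compact_support hs
  exact h1.mul_bdd (c := C) hc.aestronglyMeasurable (Filter.Eventually.of_forall hC)

lemma add_smul (hu : IntegrableOn u U) (hv : IntegrableOn v U) (hT : IsGradientMeasure U u T)
    (hS : IsGradientMeasure U v S) (a b : ℝ) :
    IsGradientMeasure U (fun x => a • u x + b • v x) (a • T + b • S) := by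
  constructor
  · have h1 : ((a • T).variation + (b • S).variation) Uᶜ = 0 := by
      simp [VectorMeasure.variation_smul, hT.1, hS.1]
    exact le_antisymm ((VectorMeasure.variation_add_le (μ := a • T) (ν := b • S) Uᶜ).trans h1.le)
      bot_le
  · intro φ h1 h2 h3 i j
    have hφ : φ ∈ testFunctions U ℝ := ⟨h1, h2, h3⟩
    have hi : ∀ R : VectorMeasure (Rd d) (RdMat d), R.Integrable φ := fun R =>
      memLp_one_iff_integrable.1 (testFunctions.memLp ⟨φ, hφ⟩ 1 R.variation)
    rw [VectorMeasure.integral_add_vectorMeasure (hi _) (hi _),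
      VectorMeasure.integral_smul_vectorMeasure, VectorMeasure.integral_smul_vectorMeasure]
    simp only [PiLp.add_apply, PiLp.smul_apply, smul_eq_mul, add_mul, mul_assoc]
    rw [integral_add ((integrable_mul_fderiv hu hφ i j).const_mul a)
      ((integrable_mul_fderiv hv hφ i j).const_mul b), integral_const_mul, integral_const_mul,
      hT.2 φ h1 h2 h3 i j, hS.2 φ h1 h2 h3 i j]
    ring

/-- Uniqueness removes the choice in the definition, so any gradient measure that has been
constructed computes the functional. -/
lemma gradientMeasure_eq (hU : IsOpen U) (hu : IntegrableOn u U) (hT : IsGradientMeasure U u T) :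
    gradientMeasure U u = T := by
  have h : MemBV U u := ⟨hu, T, hT⟩
  rw [gradientMeasure, dif_pos h]
  exact h.2.choose_spec.unique hU hT

end IsGradientMeasure

lemma MemBV.isGradientMeasure {d : ℕ} {U : Set (Rd d)} {u : Rd d → Rd d} (h : MemBV U u) :
    IsGradientMeasure U u (gradientMeasure U u) := by
  rw [gradientMeasure, dif_pos h]
  exact h.2.choose_spec

/-! ### The gradient as a functional on matrix-valued test functions -/

lemma testFunctions.coord_mem {E : Type*} [NormedAddCommGroup E] [NormedSpace ℝ E] {ι : Type*}
    [Fintype ι] {U : Set E} (Φ : testFunctions U (EuclideanSpace ℝ ι)) (i : ι) :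
    (fun x => Φ.1 x i) ∈ testFunctions U ℝ := by
  have h : tsupport (fun x => Φ.1 x i) ⊆ tsupport Φ.1 :=
    closure_mono fun x hx h0 => hx (by simp [h0])
  refine ⟨(EuclideanSpace.proj (𝕜 := ℝ) i : EuclideanSpace ℝ ι →L[ℝ] ℝ).contDiff.comp Φ.2.1, ?_,
    h.trans Φ.2.2.2⟩
  exact Φ.2.2.1.comp_left (g := fun y : EuclideanSpace ℝ ι => y i) rfl

/-- The distributional gradient of `u`, as a linear functional on matrix-valued test functions. -/
noncomputable def gradientPairing {d : ℕ} {U : Set (Rd d)} {u : Rd d → Rd d}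
    (hu : IntegrableOn u U) : testFunctions U (RdMat d) →ₗ[ℝ] ℝ where
  toFun Φ := -∑ p : Fin d × Fin d,
    ∫ x in U, u x p.1 * fderiv ℝ (fun y => Φ.1 y p) x (EuclideanSpace.single p.2 1)
  map_add' Φ Ψ := by
    rw [← neg_add, ← Finset.sum_add_distrib]
    congr 1
    refine Finset.sum_congr rfl fun p _ => ?_
    rw [← integral_add (IsGradientMeasure.integrable_mul_fderiv hu (testFunctions.coord_mem Φ p) _ _)
      (IsGradientMeasure.integrable_mul_fderiv hu (testFunctions.coord_mem Ψ p) _ _)]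
    refine integral_congr_ae (ae_of_all _ fun x => ?_)
    have h1 := (testFunctions.coord_mem Φ p).1.differentiable (by simp) x
    have h2 := (testFunctions.coord_mem Ψ p).1.differentiable (by simp) x
    have : (fun y => (Φ + Ψ).1 y p) = (fun y => Φ.1 y p) + (fun y => Ψ.1 y p) := by
      ext y; simp
    simp only [this, fderiv_add h1 h2, add_apply]
    ring
  map_smul' c Φ := by
    simp only [RingHom.id_apply, smul_eq_mul, mul_neg, Finset.mul_sum]
    congr 1
    refine Finset.sum_congr rfl fun p _ => ?_
    rw [← integral_const_mul]
    refine integral_congr_ae (ae_of_all _ fun x => ?_)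
    have h1 := (testFunctions.coord_mem Φ p).1.differentiable (by simp) x
    have : (fun y => (c • Φ).1 y p) = c • (fun y => Φ.1 y p) := by
      ext y; simp
    simp only [this, fderiv_const_smul h1, smul_apply, smul_eq_mul]
    ring

lemma gradientPairing_smul_single {d : ℕ} {U : Set (Rd d)} {u : Rd d → Rd d}
    (hu : IntegrableOn u U) {φ : Rd d → ℝ} (hφ : φ ∈ testFunctions U ℝ) (p : Fin d × Fin d) :
    gradientPairing hu ⟨_, testFunctions.smul_single_mem hφ p⟩ =
      -∫ x in U, u x p.1 * fderiv ℝ φ x (EuclideanSpace.single p.2 1) := by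
  simp only [gradientPairing, LinearMap.coe_mk, AddHom.coe_mk]
  rw [Finset.sum_eq_single p]
  · simp
  · intro q _ hq
    simp [hq]
  · simp

lemma IsGradientMeasure.abs_gradientPairing_le {d : ℕ} {U : Set (Rd d)} {u : Rd d → Rd d}
    (hu : IntegrableOn u U) {T : VectorMeasure (Rd d) (RdMat d)} (hT : IsGradientMeasure U u T)
    (Φ : testFunctions U (RdMat d)) :
    |gradientPairing hu Φ| ≤ ∫ x, ‖Φ.1 x‖ ∂T.variation := by
  refine le_trans (le_of_eq ?_) (T.abs_sum_integral_coord_le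
    (memLp_one_iff_integrable.1 (testFunctions.memLp Φ 1 T.variation)))
  simp only [gradientPairing, LinearMap.coe_mk, AddHom.coe_mk]
  congr 1
  rw [← Finset.sum_neg_distrib]
  refine Finset.sum_congr rfl fun p _ => ?_
  obtain ⟨h1, h2, h3⟩ := testFunctions.coord_mem Φ p
  rw [hT.2 _ h1 h2 h3 p.2 p.1, neg_neg]

/-- A density which represents the distributional gradient yields the gradient measure. -/
lemma isGradientMeasure_withDensityᵥ {d : ℕ} {U : Set (Rd d)} {u : Rd d → Rd d}
    (hu : IntegrableOn u U) {σ : Measure (Rd d)} {g : Rd d → RdMat d} (hg : Integrable g σ)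
    (hσ : σ Uᶜ = 0) (h : ∀ Φ : testFunctions U (RdMat d),
      gradientPairing hu Φ = ∫ x, inner ℝ (g x) (Φ.1 x) ∂σ) :
    IsGradientMeasure U u (σ.withDensityᵥ g) := by
  constructor
  · rw [Measure.variation_withDensityᵥ hg]
    exact withDensity_absolutelyContinuous _ _ hσ
  · intro φ h1 h2 h3 i j
    have hφ : φ ∈ testFunctions U ℝ := ⟨h1, h2, h3⟩
    obtain ⟨C, hC⟩ := h1.continuous.bounded_above_of_compact_support h2
    have h4 := (gradientPairing_smul_single hu hφ (j, i)).symm.trans (h _)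
    have h5 : Integrable (fun x => φ x • g x) σ :=
      hg.bdd_smul C h1.continuous.aestronglyMeasurable (ae_of_all _ hC)
    have h6 : ∫ x, φ x * g x (j, i) ∂σ = (∫ x, φ x • g x ∂σ) (j, i) :=
      (EuclideanSpace.proj (𝕜 := ℝ) (j, i) : RdMat d →L[ℝ] ℝ).integral_comp_comm h5
    have h7 : ∫ x, inner ℝ (g x) (φ x • EuclideanSpace.single (j, i) (1 : ℝ)) ∂σ =
        ∫ x, φ x * g x (j, i) ∂σ := by
      refine integral_congr_ae (ae_of_all _ fun x => ?_)
      simp [inner_smul_right, EuclideanSpace.inner_single_right]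
    rw [VectorMeasure.integral_smul_withDensityᵥ hg h1.continuous.stronglyMeasurable hC, ← h6,
      ← h7, ← neg_eq_iff_eq_neg]
    exact h4

/-! ### Lower semicontinuity of the weighted total variation -/

lemma integrableOn_sq_of_continuousOn_closure {E : Type*} [NormedAddCommGroup E] [NormedSpace ℝ E]
    [FiniteDimensional ℝ E] [MeasurableSpace E] [BorelSpace E] {U : Set E}
    (hUb : Bornology.IsBounded U) {ρ : E → ℝ} (hρ : ContinuousOn ρ (closure U)) (σ : Measure E)
    [IsFiniteMeasure σ] : IntegrableOn (fun x => ρ x ^ 2) U σ :=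
  ((hρ.pow 2).integrableOn_compact hUb.isCompact_closure).mono_set subset_closure

open Filter Topology in
/-- Sequential lower semicontinuity of the weighted total variation, together with the
compactness which provides the gradient measure of the limit. -/
theorem IsGradientMeasure.exists_of_tendsto {d : ℕ} {U : Set (Rd d)} (hUo : IsOpen U)
    (hUb : Bornology.IsBounded U) {ρ : Rd d → ℝ} (hρ : ContinuousOn ρ (closure U)) {m : ℝ}
    (hm : 0 < m) (hρm : ∀ x ∈ closure U, m ≤ ρ x) {u : ℕ → Rd d → Rd d} {v : Rd d → Rd d}
    (hu : ∀ n, IntegrableOn (u n) U) (hv : IntegrableOn v U)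
    {T : ℕ → VectorMeasure (Rd d) (RdMat d)} (hT : ∀ n, IsGradientMeasure U (u n) (T n))
    (huv : ∀ Φ, Tendsto (fun n => gradientPairing (hu n) Φ) atTop (𝓝 (gradientPairing hv Φ)))
    {L : ℝ} (hL : Tendsto (fun n => ∫ x in U, ρ x ^ 2 ∂(T n).variation) atTop (𝓝 L)) :
    ∃ S, IsGradientMeasure U v S ∧ ∫ x in U, ρ x ^ 2 ∂S.variation ≤ L := by
  have hUm := hUo.measurableSet
  have hρU : ContinuousOn ρ U := hρ.mono subset_closure
  have hpos : ∀ x ∈ U, 0 < ρ x ^ 2 := fun x hx =>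
    pow_pos (hm.trans_le (hρm x (subset_closure hx))) 2
  have hmeas : ∀ σ : Measure (Rd d), AEMeasurable (fun x => ENNReal.ofReal (ρ x ^ 2))
      (σ.restrict U) := fun σ => ((hρU.pow 2).aemeasurable hUm).ennreal_ofReal
  have hmeas' : ∀ σ : Measure (Rd d), AEMeasurable (fun x => ENNReal.ofReal (ρ x ^ 2)⁻¹)
      (σ.restrict U) := fun σ =>
    (((hρU.pow 2).inv₀ fun x hx => (hpos x hx).ne').aemeasurable hUm).ennreal_ofReal
  -- the weighted variation measures
  let ν : ℕ → FiniteMeasure (Rd d) := fun n =>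
    ⟨((T n).variation.restrict U).withDensity fun x => ENNReal.ofReal (ρ x ^ 2),
      isFiniteMeasure_withDensity_ofReal
        (integrableOn_sq_of_continuousOn_closure hUb hρ (T n).variation).2⟩
  have hνint : ∀ n (f : Rd d → ℝ), ∫ x, f x ∂(ν n : Measure (Rd d)) =
      ∫ x in U, ρ x ^ 2 * f x ∂(T n).variation := by
    intro n f
    change ∫ x, f x ∂(((T n).variation.restrict U).withDensity fun x => ENNReal.ofReal (ρ x ^ 2)) = _
    rw [integral_withDensity_eq_integral_toReal_smul₀ (hmeas _) (ae_of_all _ fun _ => by simp)]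
    simp [ENNReal.toReal_ofReal (sq_nonneg _)]
  have hνmass : ∀ n, (ν n : Measure (Rd d)).real univ = ∫ x in U, ρ x ^ 2 ∂(T n).variation := by
    intro n
    have := hνint n fun _ => 1
    simpa using this
  obtain ⟨C, hC⟩ := hL.bddAbove_range
  have hνC : ∀ n, ν n ∈ {μ : FiniteMeasure (Rd d) | μ.mass ≤ C.toNNReal ∧ μ (closure U)ᶜ = 0} := by
    intro n
    constructor
    · rw [← NNReal.coe_le_coe]
      refine le_trans ?_ (Real.le_coe_toNNReal C)
      exact (hνmass n).le.trans (hC ⟨n, rfl⟩)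
    · rw [FiniteMeasure.null_iff_toMeasure_null]
      change (((T n).variation.restrict U).withDensity fun x => ENNReal.ofReal (ρ x ^ 2)) _ = 0
      refine withDensity_absolutelyContinuous _ _ ?_
      rw [Measure.restrict_apply isClosed_closure.measurableSet.compl]
      rw [show (closure U)ᶜ ∩ U = ∅ from by
        rw [← disjoint_iff_inter_eq_empty]
        exact disjoint_compl_left.mono_right subset_closure, measure_empty]
  -- A limit along an ultrafilter finer than `atTop` replaces the extraction of a subsequence.
  obtain ⟨ν₀, -, hν₀⟩ := (isCompact_setOfPred_finiteMeasure_le_of_isCompact C.toNNReal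
    hUb.isCompact_closure).ultrafilter_le_nhds' ((hyperfilter ℕ).map ν) (by
      exact Filter.Eventually.of_forall (p := fun n => ν n ∈ _) hνC)
  have hlim : Tendsto ν (hyperfilter ℕ) (𝓝 ν₀) := hν₀
  have hle : (hyperfilter ℕ : Filter ℕ) ≤ atTop := Nat.hyperfilter_le_atTop
  rw [FiniteMeasure.tendsto_iff_forall_integral_tendsto] at hlim
  have hmass : (ν₀ : Measure (Rd d)).real univ = L := by
    have h1 := hlim (BoundedContinuousFunction.const _ 1)
    simp only [BoundedContinuousFunction.const_apply, integral_const, smul_eq_mul, mul_one,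
      hνmass] at h1
    exact tendsto_nhds_unique h1 (hL.mono_left hle)
  -- Mass of `ν₀` that has escaped to the boundary of `U` is discarded here; this only decreases the
  -- final integral.
  let σ : Measure (Rd d) := ((ν₀ : Measure (Rd d)).restrict U).withDensity
    fun x => ENNReal.ofReal (ρ x ^ 2)⁻¹
  have hσint : ∀ (f : Rd d → ℝ), ∫ x, f x ∂σ = ∫ x in U, (ρ x ^ 2)⁻¹ * f x ∂(ν₀ : Measure (Rd d)) := by
    intro f
    rw [integral_withDensity_eq_integral_toReal_smul₀ (hmeas' _) (ae_of_all _ fun _ => by simp)]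
    simp [ENNReal.toReal_ofReal (inv_nonneg.2 (sq_nonneg _))]
  have hσfin : IsFiniteMeasure σ := by
    refine isFiniteMeasure_withDensity_ofReal ?_
    refine HasFiniteIntegral.of_bounded (C := (m ^ 2)⁻¹) ?_
    refine (ae_restrict_iff' hUm).2 (ae_of_all _ fun x hx => ?_)
    rw [Real.norm_of_nonneg (inv_nonneg.2 (sq_nonneg _))]
    have := hρm x (subset_closure hx)
    gcongr
  have hσU : σ Uᶜ = 0 := withDensity_absolutelyContinuous _ _ (by
    rw [Measure.restrict_apply hUm.compl]; simp)
  -- the bound for the limit functional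
  have hbound : ∀ Φ, |gradientPairing hv Φ| ≤ ∫ x, ‖Φ.1 x‖ ∂σ := by
    intro Φ
    -- The weight `ρ⁻²` is controlled only on the closure of `U`, but `Φ` has its support inside
    -- `U`, so the product is continuous everywhere and may be tested against narrow convergence.
    have hk : Continuous fun x => ‖Φ.1 x‖ * (ρ x ^ 2)⁻¹ := by
      refine ContinuousOn.continuous_of_tsupport_subset ?_ hUo
        ((tsupport_mul_subset_left).trans ((tsupport_comp_subset norm_zero Φ.1).trans Φ.2.2.2))
      exact Φ.2.1.continuous.norm.continuousOn.mul
        ((hρU.pow 2).inv₀ fun x hx => (hpos x hx).ne')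
    have hks : HasCompactSupport fun x => ‖Φ.1 x‖ * (ρ x ^ 2)⁻¹ := Φ.2.2.1.norm.mul_right
    obtain ⟨B, hB⟩ := hk.bounded_above_of_compact_support hks
    have h1 := hlim (BoundedContinuousFunction.ofNormedAddCommGroup _ hk B hB)
    simp only [BoundedContinuousFunction.coe_ofNormedAddCommGroup] at h1
    have h2 : ∀ n, ∫ x, ‖Φ.1 x‖ * (ρ x ^ 2)⁻¹ ∂(ν n : Measure (Rd d)) =
        ∫ x, ‖Φ.1 x‖ ∂(T n).variation := by
      intro n
      have h3 : (T n).variation.restrict U = (T n).variation :=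
        Measure.restrict_eq_self_of_ae_mem (mem_ae_iff.2 (hT n).1)
      rw [hνint]
      conv_rhs => rw [← h3]
      refine setIntegral_congr_fun hUm fun x hx => ?_
      exact (mul_left_comm _ _ _).trans (by rw [mul_inv_cancel₀ (hpos x hx).ne', mul_one])
    have h3 : ∫ x, ‖Φ.1 x‖ * (ρ x ^ 2)⁻¹ ∂(ν₀ : Measure (Rd d)) = ∫ x, ‖Φ.1 x‖ ∂σ := by
      rw [hσint, setIntegral_eq_integral_of_forall_compl_eq_zero]
      · simp only [mul_comm]
      · intro x hx
        have : Φ.1 x = 0 := image_eq_zero_of_notMem_tsupport fun h => hx (Φ.2.2.2 h)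
        simp [this]
    rw [h3] at h1
    simp only [h2] at h1
    exact le_of_tendsto_of_tendsto' ((huv Φ).abs.mono_left hle) h1
      fun n => (hT n).abs_gradientPairing_le (hu n) Φ
  obtain ⟨g, hg, hg1, hgΦ⟩ := testFunctions.exists_density hUo σ hσU _ hbound
  have hvar : (σ.withDensityᵥ g).variation ≤ σ := by
    rw [Measure.variation_withDensityᵥ hg]
    calc σ.withDensity (fun x => ‖g x‖ₑ) ≤ σ.withDensity (fun _ => 1) :=
          withDensity_mono (hg1.mono fun x hx => by
            change ‖g x‖ₑ ≤ 1
            rw [← ofReal_norm]; exact ENNReal.ofReal_le_one.2 hx)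
      _ = σ := withDensity_one
  refine ⟨σ.withDensityᵥ g, isGradientMeasure_withDensityᵥ hv hg hσU hgΦ, ?_⟩
  · calc ∫ x in U, ρ x ^ 2 ∂(σ.withDensityᵥ g).variation ≤ ∫ x in U, ρ x ^ 2 ∂σ :=
          integral_mono_measure (Measure.restrict_mono le_rfl hvar)
            (ae_of_all _ fun x => sq_nonneg _)
            (integrableOn_sq_of_continuousOn_closure hUb hρ σ)
      _ = ∫ x, ρ x ^ 2 ∂σ := by
          rw [Measure.restrict_eq_self_of_ae_mem (mem_ae_iff.2 hσU)]
      _ = (ν₀ : Measure (Rd d)).real U := by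
          rw [hσint, ← setIntegral_one_eq_measureReal]
          refine setIntegral_congr_fun hUm fun x hx => ?_
          exact inv_mul_cancel₀ (hpos x hx).ne'
      _ ≤ L := by
          rw [← hmass]
          exact measureReal_mono (subset_univ _)

/-! ### Positivity of the constant -/

/-- One term of the exponential series, `(1 + t)^(k+2) / (k+2)! ≤ e^(1+t)`, dominates the function
by a multiple of `(1 + t)^(-(k+1))`, integrable in dimension `k`. -/
lemma integrable_exp_neg_norm_mul_norm (E : Type*) [NormedAddCommGroup E] [NormedSpace ℝ E]
    [FiniteDimensional ℝ E] [MeasurableSpace E] [BorelSpace E] (μ : Measure E)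
    [μ.IsAddHaarMeasure] : Integrable (fun y => Real.exp (-‖y‖) * ‖y‖) μ := by
  set k := Module.finrank ℝ E
  have h1 : Integrable (fun y : E => (1 + ‖y‖) ^ (-((k + 1 : ℕ) : ℝ))) μ :=
    integrable_one_add_norm (by push_cast; linarith)
  refine (h1.const_mul (((k + 2).factorial : ℝ) * Real.exp 1)).mono'
    (by fun_prop) (ae_of_all _ fun y => ?_)
  have h0 : 0 ≤ ‖y‖ := norm_nonneg y
  have h2 := Real.pow_div_factorial_le_exp (1 + ‖y‖) (by positivity) (k + 2)
  rw [Real.norm_of_nonneg (by positivity), Real.rpow_neg (by positivity), Real.rpow_natCast,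
    Real.exp_neg, ← div_eq_mul_inv, inv_mul_eq_div, div_le_div_iff₀ (Real.exp_pos _) (by positivity)]
  rw [Real.exp_add, div_le_iff₀ (by positivity)] at h2
  calc ‖y‖ * (1 + ‖y‖) ^ (k + 1) ≤ (1 + ‖y‖) * (1 + ‖y‖) ^ (k + 1) := by gcongr; linarith
    _ = (1 + ‖y‖) ^ (k + 2) := by ring
    _ ≤ _ := by linarith

lemma fusionConst_pos (d : ℕ) [NeZero d] : 0 < fusionConst d := by
  have hb : ∀ y : Rd d, |inner ℝ y (EuclideanSpace.single (0 : Fin d) (1 : ℝ))| ≤ ‖y‖ := fun y => by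
    simpa using abs_real_inner_le_norm y (EuclideanSpace.single (0 : Fin d) (1 : ℝ))
  have hc : Continuous fun y : Rd d =>
      Real.exp (-‖y‖) * |inner ℝ y (EuclideanSpace.single (0 : Fin d) (1 : ℝ))| := by fun_prop
  refine integral_pos_of_integrable_nonneg_nonzero (x := EuclideanSpace.single 0 1) hc
    ((integrable_exp_neg_norm_mul_norm (Rd d) volume).mono' hc.aestronglyMeasurable
      (ae_of_all _ fun y => ?_)) (fun y => by positivity) (by simp)
  rw [Real.norm_of_nonneg (by positivity)]
  gcongr
  exact hb y

/-! ### The direct method in a Hilbert space -/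

open Filter Topology in
/-- The direct method for the sum of a squared Hilbert norm and a midpoint convex, lower
semicontinuous penalty. -/
theorem existsUnique_isMinOn_norm_sq_add {X H : Type*} [NormedAddCommGroup X] [NormedSpace ℝ X]
    [CompleteSpace X] [NormedAddCommGroup H] [InnerProductSpace ℝ H] {S : Set X}
    (hne : S.Nonempty) {w : X → H} (hw : Continuous w)
    (hwmid : ∀ u v, w ((1 / 2 : ℝ) • u + (1 / 2 : ℝ) • v) = (1 / 2 : ℝ) • w u + (1 / 2 : ℝ) • w v)
    {K : ℝ} (hK : ∀ u v, ‖u - v‖ ≤ K * ‖w u - w v‖) {R : X → ℝ} (hR : ∀ u, 0 ≤ R u)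
    (hmid : ∀ u ∈ S, ∀ v ∈ S, (1 / 2 : ℝ) • u + (1 / 2 : ℝ) • v ∈ S ∧
      R ((1 / 2 : ℝ) • u + (1 / 2 : ℝ) • v) ≤ 1 / 2 * R u + 1 / 2 * R v)
    (hlsc : ∀ (u : ℕ → X) (v : X) (L : ℝ), (∀ n, u n ∈ S) → Tendsto u atTop (𝓝 v) →
      Tendsto (fun n => R (u n)) atTop (𝓝 L) → v ∈ S ∧ R v ≤ L) :
    ∃! u, u ∈ S ∧ IsMinOn (fun v => ‖w v‖ ^ 2 + R v) S u := by
  set J : X → ℝ := fun v => ‖w v‖ ^ 2 + R v with hJ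
  have hJ0 : ∀ u, 0 ≤ J u := fun u => add_nonneg (sq_nonneg _) (hR u)
  have hbdd : BddBelow (J '' S) := ⟨0, by rintro _ ⟨u, -, rfl⟩; exact hJ0 u⟩
  set I := sInf (J '' S) with hI
  have hIle : ∀ u ∈ S, I ≤ J u := fun u hu => csInf_le hbdd ⟨u, hu, rfl⟩
  have hpar : ∀ u v, ‖(1 / 2 : ℝ) • w u + (1 / 2 : ℝ) • w v‖ ^ 2 =
      1 / 2 * ‖w u‖ ^ 2 + 1 / 2 * ‖w v‖ ^ 2 - 1 / 4 * ‖w u - w v‖ ^ 2 := by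
    intro u v
    rw [norm_add_sq_real, norm_sub_sq_real, norm_smul, norm_smul, inner_smul_left,
      inner_smul_right]
    norm_num
    ring
  -- The midpoint is a competitor, so `I ≤ J u / 2 + J v / 2 - ‖w u - w v‖² / 4`.
  have hsq : ∀ u ∈ S, ∀ v ∈ S, ‖w u - w v‖ ^ 2 ≤ 2 * (J u - I) + 2 * (J v - I) := by
    intro u hu v hv
    obtain ⟨h1, h2⟩ := hmid u hu v hv
    have h3 := hIle _ h1
    simp only [hJ] at h3 ⊢
    rw [hwmid, hpar] at h3
    linarith
  have hmin : ∀ u, u ∈ S ∧ IsMinOn J S u ↔ u ∈ S ∧ J u ≤ I := by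
    refine fun u => and_congr_right fun hu => ⟨fun h => ?_, fun h v hv => h.trans (hIle v hv)⟩
    exact le_csInf (hne.image J) (by rintro _ ⟨v, hv, rfl⟩; exact h hv)
  have hK' : ∀ u v, ‖u - v‖ ≤ |K| * ‖w u - w v‖ := fun u v =>
    (hK u v).trans (by gcongr; exact le_abs_self K)
  simp only [hmin]
  obtain ⟨a, -, ha, haS⟩ := exists_seq_tendsto_sInf (hne.image J) hbdd
  choose u huS hua using haS
  have hJu : Tendsto (fun n => J (u n)) atTop (𝓝 I) := by simpa only [hua] using ha
  have hcau : CauchySeq u := by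
    rw [Metric.cauchySeq_iff']
    intro ε hε
    obtain ⟨δ, hδ, hδε⟩ : ∃ δ > 0, |K| * δ < ε :=
      ⟨ε / (|K| + 1), by positivity, by
        rw [mul_div_assoc', div_lt_iff₀ (by positivity)]
        nlinarith [abs_nonneg K]⟩
    have h1 : ∀ᶠ n in atTop, J (u n) < I + δ ^ 2 / 4 :=
      hJu.eventually_lt_const (by linarith [pow_pos hδ 2])
    obtain ⟨N, hN⟩ := eventually_atTop.1 h1
    refine ⟨N, fun n hn => ?_⟩
    rw [dist_eq_norm]
    refine (hK' _ _).trans_lt (lt_of_le_of_lt ?_ hδε)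
    have h2 := hsq _ (huS n) _ (huS N)
    have h3 := hN n hn
    have h4 := hN N le_rfl
    gcongr
    exact le_of_sq_le_sq (by linarith) hδ.le
  obtain ⟨v, hv⟩ := cauchySeq_tendsto_of_complete hcau
  -- Strong convergence of `u` makes the quadratic term converge, so the penalties converge too, and
  -- semicontinuity is needed only along sequences with convergent penalty.
  have hRn : Tendsto (fun n => R (u n)) atTop (𝓝 (I - ‖w v‖ ^ 2)) := by
    have h1 : Tendsto (fun n => ‖w (u n)‖ ^ 2) atTop (𝓝 (‖w v‖ ^ 2)) :=
      (((hw.tendsto v).comp hv).norm).pow 2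
    refine (hJu.sub h1).congr fun n => ?_
    simp [hJ]
  obtain ⟨hvS, hvR⟩ := hlsc u v _ huS hv hRn
  refine ⟨v, ⟨hvS, by simp only [hJ]; linarith⟩, fun z hz => ?_⟩
  have h1 := hsq z hz.1 v hvS
  have h2 : J v ≤ I := by simp only [hJ]; linarith
  have h3 : ‖w z - w v‖ = 0 := by
    have : ‖w z - w v‖ ^ 2 ≤ 0 := by linarith [hz.2]
    exact pow_eq_zero_iff two_ne_zero |>.1 (le_antisymm this (sq_nonneg _))
  have h4 := hK z v
  rw [h3, mul_zero] at h4
  exact sub_eq_zero.1 (norm_le_zero_iff.1 h4)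

/-! ### Continuity, convexity and the conclusion -/

open Filter Topology in
-- Each term of the pairing is the inner product of the function with a fixed `L²` function, a
-- derivative of a test function times a basis vector.
lemma tendsto_gradientPairing {d : ℕ} {U : Set (Rd d)} {u : ℕ → Lp (Rd d) 2 (volume.restrict U)}
    {v : Lp (Rd d) 2 (volume.restrict U)} (hu : ∀ n, IntegrableOn (u n) U)
    (hv : IntegrableOn v U) (huv : Tendsto u atTop (𝓝 v)) (Φ : testFunctions U (RdMat d)) :
    Tendsto (fun n => gradientPairing (hu n) Φ) atTop (𝓝 (gradientPairing hv Φ)) := by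
  simp only [gradientPairing, LinearMap.coe_mk, AddHom.coe_mk]
  refine (tendsto_finsetSum _ fun p _ => ?_).neg
  obtain ⟨h1, h2, -⟩ := testFunctions.coord_mem Φ p
  set ψ : Rd d → ℝ := fun x => fderiv ℝ (fun y => Φ.1 y p) x (EuclideanSpace.single p.2 1)
  have hc : Continuous ψ := (h1.continuous_fderiv (by simp)).clm_apply continuous_const
  have hs : HasCompactSupport ψ := h2.fderiv_apply ℝ (EuclideanSpace.single p.2 1)
  have hm : MemLp (fun x => ψ x • (EuclideanSpace.single p.1 1 : Rd d)) 2 (volume.restrict U) :=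
    (hc.smul continuous_const).memLp_of_hasCompactSupport hs.smul_right
  have key : ∀ f : Lp (Rd d) 2 (volume.restrict U),
      ∫ x in U, f x p.1 * ψ x = inner ℝ f (hm.toLp _) := by
    intro f
    rw [L2.inner_def]
    refine integral_congr_ae ?_
    filter_upwards [hm.coeFn_toLp] with x hx
    rw [hx]
    simp [inner_smul_right, EuclideanSpace.inner_single_right, mul_comm]
  change Tendsto (fun n => ∫ x in U, u n x p.1 * ψ x) atTop (𝓝 (∫ x in U, v x p.1 * ψ x))
  simp_rw [key]
  exact huv.inner tendsto_const_nhds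

/-- Weighted total variation is midpoint convex. -/
lemma IsGradientMeasure.integral_variation_midpoint_le {d : ℕ} {U : Set (Rd d)}
    (hUb : Bornology.IsBounded U) {ρ : Rd d → ℝ} (hρ : ContinuousOn ρ (closure U))
    (T S : VectorMeasure (Rd d) (RdMat d)) :
    ∫ x in U, ρ x ^ 2 ∂((1 / 2 : ℝ) • T + (1 / 2 : ℝ) • S).variation ≤
      1 / 2 * (∫ x in U, ρ x ^ 2 ∂T.variation) + 1 / 2 * (∫ x in U, ρ x ^ 2 ∂S.variation) := by
  have hi := fun Q : VectorMeasure (Rd d) (RdMat d) =>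
    integrableOn_sq_of_continuousOn_closure hUb hρ Q.variation
  have hi' : ∀ Q : VectorMeasure (Rd d) (RdMat d),
      Integrable (fun x => ρ x ^ 2) ((((1 / 2 : ℝ) • Q).variation).restrict U) := fun Q => hi _
  have hs : ∀ Q : VectorMeasure (Rd d) (RdMat d),
      ∫ x in U, ρ x ^ 2 ∂((1 / 2 : ℝ) • Q).variation =
        1 / 2 * (∫ x in U, ρ x ^ 2 ∂Q.variation) := by
    intro Q
    rw [VectorMeasure.variation_smul, Measure.restrict_smul, integral_smul_nnreal_measure]
    simp [NNReal.smul_def]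
  rw [← hs T, ← hs S, ← integral_add_measure (hi' T) (hi' S), ← Measure.restrict_add]
  refine integral_mono_measure (Measure.restrict_mono le_rfl VectorMeasure.variation_add_le)
    (ae_of_all _ fun x => sq_nonneg _) ?_
  rw [Measure.restrict_add]
  exact (hi' T).add_measure (hi' S)

theorem proposition2p1 {d : ℕ} [NeZero d] (U : Set (Rd d)) (hUo : IsOpen U)
    (hUb : Bornology.IsBounded U) (μ : Measure (Rd d)) (ρ : Rd d → ℝ)
    (hρ : ContinuousOn ρ (closure U)) (hρpos : ∃ m : ℝ, 0 < m ∧ ∀ x ∈ closure U, m ≤ ρ x)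
    (hμ : μ = (volume.restrict (closure U)).withDensity (fun x => ENNReal.ofReal (ρ x)))
    (lam : ℝ) (hlam : 0 < lam) :
    ∃! u : Lp (Rd d) 2 (volume.restrict U),
      u ∈ L2BV U ∧
        IsMinOn (fun v : Lp (Rd d) 2 (volume.restrict U) => gradientFunctional U μ ρ lam v)
          (L2BV U) u := by
  obtain ⟨m, hm, hρm⟩ := hρpos
  obtain ⟨M, hM⟩ : ∃ M, ∀ x ∈ closure U, ρ x ≤ M := by
    obtain ⟨M, hM⟩ := hUb.isCompact_closure.bddAbove_image hρ
    exact ⟨M, fun x hx => hM ⟨x, hx, rfl⟩⟩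
  have hUm := hUo.measurableSet
  have hμU : μ.restrict U = (volume.restrict U).withDensity (fun x => ENNReal.ofReal (ρ x)) := by
    rw [hμ, restrict_withDensity hUm, Measure.restrict_restrict hUm,
      inter_eq_left.2 subset_closure]
  have hfin : IsFiniteMeasure (volume.restrict U) :=
    ⟨by rw [Measure.restrict_apply_univ]; exact hUb.measure_lt_top⟩
  have hc : 0 < fusionConst d * lam := mul_pos (fusionConst_pos d) hlam
  have hle : μ.restrict U ≤ ENNReal.ofReal M • volume.restrict U := by
    rw [hμU, ← withDensity_const]
    exact withDensity_mono ((ae_restrict_iff' hUm).2 (ae_of_all _ fun x hx =>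
      ENNReal.ofReal_le_ofReal (hM x (subset_closure hx))))
  have hge : volume.restrict U ≤ (ENNReal.ofReal m)⁻¹ • μ.restrict U := by
    have h0 : ENNReal.ofReal m ≠ 0 := (ENNReal.ofReal_pos.2 hm).ne'
    have h1 : ENNReal.ofReal m • volume.restrict U ≤ μ.restrict U := by
      rw [hμU, ← withDensity_const]
      exact withDensity_mono ((ae_restrict_iff' hUm).2 (ae_of_all _ fun x hx =>
        ENNReal.ofReal_le_ofReal (hρm x (subset_closure hx))))
    calc volume.restrict U = (ENNReal.ofReal m)⁻¹ • ENNReal.ofReal m • volume.restrict U := by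
          rw [smul_smul, ENNReal.inv_mul_cancel h0 ENNReal.ofReal_ne_top, one_smul]
      _ ≤ _ := by gcongr
  have hcge : (ENNReal.ofReal m)⁻¹ ≠ ⊤ := ENNReal.inv_ne_top.2 (ENNReal.ofReal_pos.2 hm).ne'
  -- `A` and `B` are the identity on functions, between `L²(U)` and `L²(μ)` on `U`; they are bounded
  -- by `ρ ≤ M` and `ρ ≥ m` respectively.
  let A : Lp (Rd d) 2 (volume.restrict U) →L[ℝ] Lp (Rd d) 2 (μ.restrict U) :=
    Lp.LpToLpOfMeasureLeSMul ENNReal.ofReal_ne_top hle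
  let B : Lp (Rd d) 2 (μ.restrict U) →L[ℝ] Lp (Rd d) 2 (volume.restrict U) :=
    Lp.LpToLpOfMeasureLeSMul hcge hge
  have hac' : volume.restrict U ≪ μ.restrict U := Measure.absolutelyContinuous_of_le_smul hge
  have hA : ∀ u, A u =ᵐ[μ.restrict U] u := Lp.coeFn_LpToLpOfMeasureLeSMul _ hle
  have hB : ∀ u, B u =ᵐ[volume.restrict U] u := Lp.coeFn_LpToLpOfMeasureLeSMul hcge hge
  have hBA : ∀ u, B (A u) = u := fun u => Lp.ext ((hB _).trans (hac'.ae_eq (hA u)))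
  have hid : MemLp (fun x : Rd d => x) 2 (μ.restrict U) := by
    have h1 : MemLp (fun x : Rd d => x) 2 (volume.restrict U) := by
      obtain ⟨r, hr⟩ := hUb.exists_norm_le
      exact MemLp.of_bound aestronglyMeasurable_id r
        ((ae_restrict_iff' hUm).2 (ae_of_all _ hr))
    exact h1.of_measure_le_smul ENNReal.ofReal_ne_top hle
  let e := hid.toLp _
  let w : Lp (Rd d) 2 (volume.restrict U) → Lp (Rd d) 2 (μ.restrict U) := fun u => A u - e
  have hquad : ∀ u, ∫ x in U, ‖u x - x‖ ^ 2 ∂μ = ‖w u‖ ^ 2 := by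
    intro u
    rw [← real_inner_self_eq_norm_sq, L2.inner_def]
    refine integral_congr_ae ?_
    filter_upwards [hA u, Lp.coeFn_sub (A u) e, hid.coeFn_toLp] with x h1 h2 h3
    rw [real_inner_self_eq_norm_sq, h2, Pi.sub_apply, h1, h3]
  let R : Lp (Rd d) 2 (volume.restrict U) → ℝ := fun u =>
    fusionConst d * lam * (∫ x in U, ρ x ^ 2 ∂(gradientMeasure U u).variation)
  have hJ : (fun v : Lp (Rd d) 2 (volume.restrict U) => gradientFunctional U μ ρ lam v) =
      fun v => ‖w v‖ ^ 2 + R v := by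
    ext v
    rw [← hquad]
    rfl
  have hint : ∀ u : Lp (Rd d) 2 (volume.restrict U), IntegrableOn u U := fun u =>
    (Lp.memLp u).integrable one_le_two
  rw [hJ]
  -- Since `B` inverts `A` on the left, `u - v = B (w u - w v)`, whence `K = ‖B‖`. The zero function
  -- shows that the domain is nonempty.
  refine existsUnique_isMinOn_norm_sq_add (w := w) (R := R) (K := ‖B‖) ⟨0, ?_⟩ (A.continuous.sub continuous_const)
    ?_ ?_ (fun u => mul_nonneg hc.le (integral_nonneg fun x => sq_nonneg _)) ?_ ?_
  · refine ⟨hint 0, 0, ?_⟩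
    refine IsGradientMeasure.congr (u := 0) ⟨by simp, fun φ _ _ _ i j => ?_⟩ (Lp.coeFn_zero _ _ _).symm
    simp
  · intro u v
    simp only [w, map_add, map_smul, smul_sub]
    have : e = (1 / 2 : ℝ) • e + (1 / 2 : ℝ) • e := by rw [← add_smul]; norm_num
    nth_rewrite 1 [this]
    abel
  · intro u v
    have : u - v = B (w u - w v) := by simp [w, hBA]
    rw [this]
    exact B.le_opNorm _
  · intro u hu v hv
    have h1 : IsGradientMeasure U ((1 / 2 : ℝ) • u + (1 / 2 : ℝ) • v : Lp (Rd d) 2 (volume.restrict U))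
        ((1 / 2 : ℝ) • gradientMeasure U u + (1 / 2 : ℝ) • gradientMeasure U v) := by
      refine (IsGradientMeasure.add_smul (hint u) (hint v) (MemBV.isGradientMeasure hu)
        (MemBV.isGradientMeasure hv) (1 / 2) (1 / 2)).congr ?_
      filter_upwards [Lp.coeFn_add ((1 / 2 : ℝ) • u) ((1 / 2 : ℝ) • v),
        Lp.coeFn_smul (1 / 2 : ℝ) u, Lp.coeFn_smul (1 / 2 : ℝ) v] with x h1 h2 h3
      rw [h1, Pi.add_apply, h2, h3]
      rfl
    refine ⟨⟨hint _, _, h1⟩, ?_⟩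
    simp only [R]
    rw [h1.gradientMeasure_eq hUo (hint _)]
    have h2 := IsGradientMeasure.integral_variation_midpoint_le hUb hρ (gradientMeasure U u)
      (gradientMeasure U v)
    exact (mul_le_mul_of_nonneg_left h2 hc.le).trans (le_of_eq (by ring))
  · intro u v L hu huv hL
    have h1 : Filter.Tendsto
        (fun n => ∫ x in U, ρ x ^ 2 ∂(gradientMeasure U (u n)).variation) Filter.atTop
        (nhds ((fusionConst d * lam)⁻¹ * L)) := by
      refine (hL.const_mul (fusionConst d * lam)⁻¹).congr fun n => ?_
      simp only [R]
      rw [inv_mul_cancel_left₀ hc.ne']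
    obtain ⟨S, hS, hSL⟩ := IsGradientMeasure.exists_of_tendsto hUo hUb hρ hm hρm
      (fun n => hint (u n)) (hint v) (fun n => MemBV.isGradientMeasure (hu n))
      (tendsto_gradientPairing _ _ huv) h1
    refine ⟨⟨hint v, S, hS⟩, ?_⟩
    simp only [R]
    rw [hS.gradientMeasure_eq hUo (hint v)]
    calc _ ≤ fusionConst d * lam * ((fusionConst d * lam)⁻¹ * L) := by gcongr
      _ = L := mul_inv_cancel_left₀ hc.ne' L
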